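/- **Setting.** There are $n$ queues in discrete time $t=0,1,2,\dots$, and $S\subseteq\{0,1\}^n$ is a set of available schedules. The arrivals $A_i(t)\in\{0,1\}$ are independent Bernoulli variables with mean $\lambda_i$. If $\sigma(t)\in S$ is the schedule at time $t$, the queue lengths $Q_i(t)\in\mathbb Z_{\ge 0}$ satisfy $$Q_i(t+1)=Q_i(t)+A_i(t)-\sigma_i(t)\,\mathbf 1_{\{Q_i(t)>0\}} .$$ Let $\mathcal C$ be the convex hull of $S$, and let $\Lambda^o$ be the set of $\lambda\in\mathbb R_{\ge 0}^n$ such that $\lambda_i<c_i$ for all $i$, for some $c\in\mathcal C$. **Exhaustive-search (pick-and-compare) oracle.** An advice is a pair $(\rho,\sigma)\in\{0,1\}^n\times S$. Given weights $W\in\mathbb Z_{\ge 0}^n$ and advice $(\rho,\sigma)$, the oracle returns the schedule $\sigma_{\rm oracle}(W,(\rho,\sigma))=\hat\sigma$ and the updated advice $a_{\rm oracle}(W,(\rho,\sigma))=(\hat\rho,\hat\sigma)$. Here $\hat\sigma=\rho$ if $\rho\in S$ and $\rho\cdot W>\sigma\cdot W$, and $\hat\sigma=\sigma$ otherwise; and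 $\hat\rho=\rho+1 \bmod 2^n$, where $\rho$ is read as an integer in binary. **Algorithm.** Let $U_i(t)=\max\{f(Q_i(t)),\,g(\max_j Q_j(t))\}$. The algorithm sets $\sigma(t+1)=\sigma_{\rm oracle}(W(t),a(t))$ and $a(t+1)=a_{\rm oracle}(W(t),a(t))$. It sets $W_i(t+1)$ to the integer closest to $U_i(t+1)$ if $|W_i(t)-U_i(t+1)|\ge 2$, and $W_i(t+1)=W_i(t)$ otherwise. Then $X(t)=(\sigma(t),W(t),a(t),Q(t))$ is a Markov chain on the countable set of states with $\sigma\in S$, $a\in\{0,1\}^n\times S$ and $|W_i-U_i|\le 2$ for all $i$. **Positive recurrence.** A state is positive recurrent if the chain started from it returns to it almost surely and with finite mean return time. A state $x$ is essential if it is accessible from every state that is accessible from $x$. A countable chain, not necessarily irreducible, is called positive recurrent if every essential state is positive recurrent and there is a finite set of positive recurrent states that the chain reaches in finite mean time from every initial state. (For an irreducible chain this means that all states are positive recurrent.) **Statement.** Let $f(x)=x^a$ and $g(x)=x^b$ with $0<b<a<1$. Then the algorithm with the exhaustive-search oracle is throughput-optimal: for every $\lambda\in\Lambda^o$ the Markov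 chain $X(t)$ is positive recurrent. Moreover, the oracle finds an exact maximum-weight schedule after $2^n$ queries: for all weights $W$, all advice $\alpha$ and all $t\ge 2^n$, $$\sigma_{\rm oracle}\bigl(W,a_{\rm oracle}(W,\cdot)^{(t)}(\alpha)\bigr)\cdot W\;\ge\;\max_{\rho\in S}\rho\cdot W ,$$ where $(t)$ denotes $t$-fold composition. -/

import Mathlib

open MeasureTheory ProbabilityTheory
open scoped NNReal ENNReal

universe u

namespace OracleScheduling

/-! ### Network model -/

/-- A 0/1 vector indexed by the `n` queues; `σ i = 1` means that queue `i` is active. -/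
abbrev Schedule (n : ℕ) := Fin n → Fin 2

/-- The weight `ρ · W`. -/
def weight {n : ℕ} (ρ : Schedule n) (W : Fin n → ℕ) : ℕ := ∑ i, (ρ i : ℕ) * W i

/-- The capacity region: all convex combinations of available schedules. -/
def capacityRegion {n : ℕ} (S : Finset (Schedule n)) : Set (Fin n → ℝ) :=
  {c | ∃ α : Schedule n → ℝ, (∀ σ ∈ S, 0 ≤ α σ) ∧ ∑ σ ∈ S, α σ = 1 ∧
    ∀ i, c i = ∑ σ ∈ S, α σ * ((σ i : ℕ) : ℝ)}

/-- The strictly admissible arrival rates. -/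
def strictlyAdmissible {n : ℕ} (S : Finset (Schedule n)) : Set (Fin n → ℝ) :=
  {r | (∀ i, 0 ≤ r i) ∧ ∃ c ∈ capacityRegion S, ∀ i, r i < c i}

/-- `A t i` is the number (0 or 1) of packets arriving at queue `i` during `[t, t+1)`:
all these variables are independent, and `A t i` is Bernoulli with mean `r i`. -/
structure IsBernoulliArrivals {n : ℕ} {Ω : Type u} [MeasurableSpace Ω] (μ : Measure Ω)
    (r : Fin n → ℝ) (A : ℕ → Fin n → Ω → Fin 2) : Prop where
  measurable : ∀ t i, Measurable (A t i)
  indep : iIndepFun (fun p : ℕ × Fin n => A p.1 p.2) μ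
  mean : ∀ t i, ∫ ω, ((A t i ω : ℕ) : ℝ) ∂μ = r i

/-! ### Oracle systems and the scheduling algorithm -/

/-- A deterministic oracle system with advice space `𝔸`: a query consists of weights and advice,
the answer of an available schedule and an updated advice. -/
structure Oracle {n : ℕ} (S : Finset (Schedule n)) (𝔸 : Type) where
  /-- the schedule returned by the oracle -/
  sched : (Fin n → ℕ) → 𝔸 → S
  /-- the updated advice returned by the oracle -/
  advice : (Fin n → ℕ) → 𝔸 → 𝔸

/-- The length of the longest queue. -/
def Qmax {n : ℕ} (Q : Fin n → ℕ) : ℕ := Finset.univ.sup Q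

/-- `U i = max {f (Q i), g (Q_max)}`. -/
def U {n : ℕ} (f g : ℝ≥0 → ℝ≥0) (Q : Fin n → ℕ) (i : Fin n) : ℝ≥0 :=
  max (f (Q i : ℝ≥0)) (g (Qmax Q : ℝ≥0))

/-- The states `(σ, W, a, Q)` of the network Markov chain. -/
structure NetState {n : ℕ} (S : Finset (Schedule n)) (𝔸 : Type) (f g : ℝ≥0 → ℝ≥0) where
  /-- current schedule -/
  σ : S
  /-- current weights -/
  W : Fin n → ℕ
  /-- current advice -/
  a : 𝔸
  /-- current queue lengths -/
  Q : Fin n → ℕ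
  /-- the weights stay close to `U` -/
  close : ∀ i, |(W i : ℝ) - (U f g Q i : ℝ)| ≤ 2

open Classical in
/-- The new weight at a queue: the old weight `w` is kept unless it is at distance at least `2`
from `v`, in which case it is replaced by the integer closest to `v`. -/
noncomputable def updateWeight (w : ℕ) (v : ℝ≥0) : ℕ :=
  if 2 ≤ |(w : ℝ) - (v : ℝ)| then (round (v : ℝ)).toNat else w

theorem updateWeight_close (w : ℕ) (v : ℝ≥0) : |(updateWeight w v : ℝ) - (v : ℝ)| ≤ 2 := by
  unfold updateWeight
  split_ifs with h
  · have h0 : 0 ≤ round (v : ℝ) := by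
      rw [round_eq]
      exact Int.floor_nonneg.mpr (by positivity)
    have h1 : (((round (v : ℝ)).toNat : ℕ) : ℝ) = (round (v : ℝ) : ℝ) := by
      exact_mod_cast Int.toNat_of_nonneg h0
    rw [h1, abs_sub_comm]
    exact (abs_sub_round (v : ℝ)).trans (by norm_num)
  · exact (not_le.mp h).le

/-- The queueing dynamics `Q_i + A_i - σ_i I{Q_i > 0}` (the subtraction never truncates). -/
def nextQueue {n : ℕ} (σ : Schedule n) (Q : Fin n → ℕ) (A : Fin n → Fin 2) : Fin n → ℕ :=
  fun i => Q i + (A i : ℕ) - (if 0 < Q i then (σ i : ℕ) else 0)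

/-- One time step of the scheduling algorithm, when the arrivals are `A`. -/
noncomputable def step {n : ℕ} {S : Finset (Schedule n)} {𝔸 : Type} (O : Oracle S 𝔸)
    (f g : ℝ≥0 → ℝ≥0) (x : NetState S 𝔸 f g) (A : Fin n → Fin 2) : NetState S 𝔸 f g where
  σ := O.sched x.W x.a
  W := fun i => updateWeight (x.W i) (U f g (nextQueue x.σ x.Q A) i)
  a := O.advice x.W x.a
  Q := nextQueue x.σ x.Q A
  close := by
    intro i
    exact updateWeight_close _ _

/-- The network Markov chain started from the state `x`, at time `t`. -/
noncomputable def chain {n : ℕ} {S : Finset (Schedule n)} {𝔸 : Type} (O : Oracle S 𝔸)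
    (f g : ℝ≥0 → ℝ≥0) {Ω : Type u} (A : ℕ → Fin n → Ω → Fin 2) (x : NetState S 𝔸 f g) :
    ℕ → Ω → NetState S 𝔸 f g
  | 0, _ => x
  | t + 1, ω => step O f g (chain O f g A x t ω) (fun i => A t i ω)

/-! ### Positive recurrence

Below, `X x t ω` is the position at time `t` of a Markov chain that starts from `X x 0 ω = x`. -/

section MarkovChain

variable {E : Type} {Ω : Type u} [MeasurableSpace Ω]

/-- `inf {t ≥ 1 : X(t) ∈ F}` when `X(0) = x`, which is `⊤` if there is no such `t`. -/
noncomputable def returnTime (X : E → ℕ → Ω → E) (x : E) (F : Set E) (ω : Ω) : ℕ∞ :=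
  sInf {s : ℕ∞ | ∃ t : ℕ, s = t ∧ 1 ≤ t ∧ X x t ω ∈ F}

/-- The expectation of `returnTime X x F`. -/
noncomputable def meanReturnTime (μ : Measure Ω) (X : E → ℕ → Ω → E) (x : E) (F : Set E) :
    ℝ≥0∞ :=
  ∫⁻ ω, (returnTime X x F ω : ℝ≥0∞) ∂μ

/-- The state `x` is recurrent: the chain started from `x` returns to `x` almost surely. -/
def RecurrentState (μ : Measure Ω) (X : E → ℕ → Ω → E) (x : E) : Prop :=
  ∀ᵐ ω ∂μ, returnTime X x {x} ω < ⊤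

/-- The state `x` is positive recurrent: it is recurrent with finite mean return time. -/
def PositiveRecurrentState (μ : Measure Ω) (X : E → ℕ → Ω → E) (x : E) : Prop :=
  RecurrentState μ X x ∧ meanReturnTime μ X x {x} < ∞

/-- The state `y` is accessible from the state `x`. -/
def Accessible (μ : Measure Ω) (X : E → ℕ → Ω → E) (x y : E) : Prop :=
  ∃ t : ℕ, 0 < μ {ω | X x t ω = y}

/-- The state `x` is essential: it is accessible from every state that is accessible from it.
Inessential states are transient; in an irreducible chain every state is essential. -/
def EssentialState (μ : Measure Ω) (X : E → ℕ → Ω → E) (x : E) : Prop :=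
  ∀ y, Accessible μ X x y → Accessible μ X y x

/-- Positive recurrence of a chain that need not be irreducible: every essential state is positive
recurrent, and there is a finite set of positive recurrent states that the chain reaches in finite
mean time from every state. For an irreducible chain this says that all states are positive
recurrent. -/
structure PositiveRecurrentChain (μ : Measure Ω) (X : E → ℕ → Ω → E) : Prop where
  essential : ∀ x, EssentialState μ X x → PositiveRecurrentState μ X x
  absorbed : ∃ F : Set E, F.Finite ∧ (∀ y ∈ F, PositiveRecurrentState μ X y) ∧
    ∀ x, meanReturnTime μ X x F < ∞

end MarkovChain

/-- The scheduling algorithm with oracle `O` and functions `f`, `g` is throughput-optimal: for all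
strictly admissible arrival rates the network Markov chain is positive recurrent. -/
def ThroughputOptimal {n : ℕ} {S : Finset (Schedule n)} {𝔸 : Type} (O : Oracle S 𝔸)
    (f g : ℝ≥0 → ℝ≥0) : Prop :=
  ∀ r ∈ strictlyAdmissible S,
    ∀ (Ω : Type u) [MeasurableSpace Ω] (μ : Measure Ω) [IsProbabilityMeasure μ]
      (A : ℕ → Fin n → Ω → Fin 2), IsBernoulliArrivals μ r A →
        PositiveRecurrentChain μ (chain O f g A)

/-! ### The exhaustive-search oracle -/

/-- `ρ + 1 mod 2 ^ n`, where `ρ ∈ {0,1}^n` is read as the integer with binary digits `ρ i`. -/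
def nextIndex {n : ℕ} (ρ : Schedule n) : Schedule n :=
  finFunctionFinEquiv.symm
    ⟨((finFunctionFinEquiv ρ : Fin (2 ^ n)) + 1 : ℕ) % 2 ^ n, Nat.mod_lt _ (by positivity)⟩

/-- The schedule returned by the exhaustive-search oracle on the advice `(ρ, σ)`: the search index
`ρ` if it is an available schedule heavier than `σ`, and `σ` otherwise. -/
def pickCompare {n : ℕ} (S : Finset (Schedule n)) (W : Fin n → ℕ) (a : Schedule n × S) : S :=
  if h : a.1 ∈ S ∧ weight a.2 W < weight a.1 W then ⟨a.1, h.1⟩ else a.2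

/-- The exhaustive-search ("pick-and-compare") oracle system. -/
def esOracle {n : ℕ} (S : Finset (Schedule n)) : Oracle S (Schedule n × S) where
  sched := pickCompare S
  advice := fun W a => (nextIndex a.1, pickCompare S W a)

end OracleScheduling

/-!
The proof is a multi-step Foster–Lyapunov argument, in which the slow variation of the weights is
used only in the crude form that a weight changes by at most `5` in one time slot.

Exhaustive search compares every schedule with the current one within `2 ^ n` steps. The comparison
is made with outdated weights, but the weights of two schedules drift apart by at most `10 * n` per
step. Hence after `2 ^ n` steps the current schedule has maximal weight up to the constant
`10 * n * 2 ^ n`, from whatever state the chain starts (`SearchProgress`).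

The Lyapunov function is `∑ i, ∑ q < Q i, f q`. Its mean increment is at most
`∑ i, (r i - σ i) * f (Q i) + n`. As the weights differ from `f (Q i)` by at most `2 + g Q_max`, and
as `r i + ε ≤ c i` for a point `c` of the capacity region, a schedule of nearly maximal weight makes
this at most `n * g Q_max + const - ε * f Q_max` (`meanNext_lyapunov_le_of_weight_le`), which is
below `-1` for large `Q_max` because `b < a`. The expectation of the Lyapunov function after `2 ^ n`
steps is therefore a function of the initial state that decreases on average by at least one outside
of a finite set (`drift_iterate_meanNext`).

It remains to see that such a drift implies positive recurrence although the chain may be reducible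
(`positiveRecurrentChain_of_drift`). Given a drift function for a finite set `B` and a set `F` that
is accessible from every state of `B`, there is a drift function for `F`
(`exists_drift_of_reach`). This is applied with `F = {x}` on the states accessible from an essential
state `x`, and with the set `F` of essential states of `B`.
-/

/-! ### Chains driven by finite noise -/

namespace FiniteNoiseChain

variable {E V : Type*}

section Reach

variable (p : V → ℝ) (next : E → V → E)

/-- `y` can be reached from `x` in finitely many steps of positive probability. -/
def Reach : E → E → Prop := Relation.ReflTransGen fun x y => ∃ v, 0 < p v ∧ next x v = y

variable {p next}

theorem Reach.step {x y : E} (h : Reach p next x y) {v : V} (hv : 0 < p v) :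
    Reach p next x (next y v) :=
  Relation.ReflTransGen.tail h ⟨v, hv, rfl⟩

/-- Among the states of a finite set that the chain never leaves for good, those that are minimal
for accessibility are essential. -/
theorem exists_reach_essential {B : Set E} (hfin : B.Finite)
    (hB : ∀ x, ∃ b ∈ B, Reach p next x b) (x : E) :
    ∃ e ∈ B, (∀ y, Reach p next e y → Reach p next y e) ∧ Reach p next x e := by
  obtain ⟨b, hb, hxb⟩ := hB x
  obtain ⟨e, ⟨heB, hxe⟩, hmin⟩ :=
    Set.Finite.exists_minimalFor (fun e => {y | y ∈ B ∧ Reach p next e y})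
      {e | e ∈ B ∧ Reach p next x e} (hfin.subset fun _ h => h.1) ⟨b, hb, hxb⟩
  refine ⟨e, heB, fun y hy => ?_, hxe⟩
  obtain ⟨c, hc, hyc⟩ := hB y
  have hec : Reach p next e c := Relation.ReflTransGen.trans hy hyc
  have hsub := hmin (j := c) ⟨hc, Relation.ReflTransGen.trans hxe hec⟩
    fun z hz => ⟨hz.1, Relation.ReflTransGen.trans hec hz.2⟩
  exact Relation.ReflTransGen.trans hyc (hsub ⟨heB, Relation.ReflTransGen.refl⟩).2

end Reach

section Kernel

variable [Fintype V] (p : V → ℝ) (next : E → V → E)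

/-- The expectation of `h` after one step of the chain from `x`, where the noise `v` has
probability `p v` and moves `x` to `next x v`. -/
def meanNext (h : E → ℝ) (x : E) : ℝ := ∑ v, p v * h (next x v)

/-- The probability that the chain started from `x` avoids `F` at the times `1, …, t` and is in
`G` at time `t`. -/
noncomputable def avoidProb (F G : Set E) : ℕ → E → ℝ
  | 0 => G.indicator 1
  | t + 1 => meanNext p next (Fᶜ.indicator (avoidProb F G t))

variable {p next}

theorem meanNext_add (h k : E → ℝ) (x : E) :
    meanNext p next (fun y => h y + k y) x = meanNext p next h x + meanNext p next k x := by
  simp [meanNext, mul_add, Finset.sum_add_distrib]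

theorem meanNext_const_mul (c : ℝ) (h : E → ℝ) (x : E) :
    meanNext p next (fun y => c * h y) x = c * meanNext p next h x := by
  simp only [meanNext, Finset.mul_sum]
  exact Finset.sum_congr rfl fun v _ => by ring

theorem meanNext_sum {ι : Type*} (s : Finset ι) (h : ι → E → ℝ) (x : E) :
    meanNext p next (fun y => ∑ i ∈ s, h i y) x = ∑ i ∈ s, meanNext p next (h i) x := by
  simp only [meanNext, Finset.mul_sum]
  exact Finset.sum_comm

theorem meanNext_const (hp1 : ∑ v, p v = 1) (c : ℝ) (x : E) :
    meanNext p next (fun _ => c) x = c := by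
  simp [meanNext, ← Finset.sum_mul, hp1]

theorem meanNext_mono (hp : ∀ v, 0 ≤ p v) {h k : E → ℝ} {x : E}
    (hhk : ∀ v, 0 < p v → h (next x v) ≤ k (next x v)) :
    meanNext p next h x ≤ meanNext p next k x := by
  refine Finset.sum_le_sum fun v _ => ?_
  rcases (hp v).eq_or_lt with hv | hv
  · simp [← hv]
  · exact mul_le_mul_of_nonneg_left (hhk v hv) hv.le

theorem meanNext_nonneg (hp : ∀ v, 0 ≤ p v) {h : E → ℝ} (hh : ∀ y, 0 ≤ h y) (x : E) :
    0 ≤ meanNext p next h x :=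
  Finset.sum_nonneg fun v _ => mul_nonneg (hp v) (hh _)

theorem avoidProb_nonneg (hp : ∀ v, 0 ≤ p v) (F G : Set E) (t : ℕ) (x : E) :
    0 ≤ avoidProb p next F G t x := by
  induction t generalizing x with
  | zero => exact Set.indicator_nonneg (fun _ _ => zero_le_one) x
  | succ t ih => exact meanNext_nonneg hp (fun y => Set.indicator_nonneg (fun z _ => ih z) y) x

theorem avoidProb_le_one (hp : ∀ v, 0 ≤ p v) (hp1 : ∑ v, p v = 1) (F G : Set E) (t : ℕ) (x : E) :
    avoidProb p next F G t x ≤ 1 := by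
  induction t generalizing x with
  | zero => exact Set.indicator_le_self' (fun _ _ => zero_le_one) x
  | succ t ih =>
    rw [← meanNext_const (next := next) hp1 1 x]
    exact meanNext_mono hp fun v _ => Set.indicator_apply_le' (fun _ => ih _) fun _ => zero_le_one

theorem avoidProb_empty_univ (hp1 : ∑ v, p v = 1) (t : ℕ) (x : E) :
    avoidProb p next ∅ Set.univ t x = 1 := by
  induction t generalizing x with
  | zero => simp [avoidProb]
  | succ t ih =>
    rw [avoidProb, Set.compl_empty, Set.indicator_univ, funext ih]
    exact meanNext_const hp1 1 x

/-- Foster's criterion, for the chain restricted to a closed set `C`: if `φ` decreases on average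
by at least one outside of `F`, then the mean return time to `F`, which is the sum of the
probabilities to avoid `F` up to time `t`, is finite. -/
theorem sum_avoidProb_le (hp : ∀ v, 0 ≤ p v) (hp1 : ∑ v, p v = 1) {C F : Set E} {φ : E → ℝ}
    (hC : ∀ x ∈ C, ∀ v, 0 < p v → next x v ∈ C) (hφ0 : ∀ x, 0 ≤ φ x)
    (hφ : ∀ x ∈ C, x ∉ F → 1 + meanNext p next φ x ≤ φ x) (N : ℕ) {x : E} (hx : x ∈ C) :
    ∑ t ∈ Finset.range N, avoidProb p next F Set.univ t x ≤ 1 + meanNext p next φ x := by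
  induction N generalizing x with
  | zero => simpa using add_nonneg zero_le_one (meanNext_nonneg hp hφ0 x)
  | succ N ih =>
    rw [Finset.sum_range_succ', add_comm]
    refine add_le_add (avoidProb_le_one hp hp1 _ _ _ _) ?_
    have h := meanNext_sum (p := p) (next := next) (Finset.range N)
      (fun t => Fᶜ.indicator (avoidProb p next F Set.univ t)) x
    refine (show _ = _ from h.symm).trans_le (meanNext_mono hp fun v hv => ?_)
    by_cases hF : next x v ∈ F
    · simpa [hF] using hφ0 _
    · simpa [hF] using (ih (hC x hx v hv)).trans (hφ _ (hC x hx v hv) hF)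

/-- The chain cannot stay outside of a set where Foster's criterion holds. -/
theorem exists_reach_of_drift (hp : ∀ v, 0 ≤ p v) (hp1 : ∑ v, p v = 1) {B : Set E} {φ : E → ℝ}
    (hφ0 : ∀ x, 0 ≤ φ x) (hφ : ∀ x, x ∉ B → 1 + meanNext p next φ x ≤ φ x) (x : E) :
    ∃ b ∈ B, Reach p next x b := by
  by_contra! hB
  obtain ⟨N, hN⟩ := exists_nat_gt (1 + meanNext p next φ x)
  have h := sum_avoidProb_le hp hp1 (C := {y | Reach p next x y}) (F := ∅)
    (fun y hy v hv => Reach.step hy hv) hφ0 (fun y hy _ => hφ y fun hyB => hB y hyB hy) N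
    (x := x) Relation.ReflTransGen.refl
  simp only [avoidProb_empty_univ hp1, Finset.sum_const, Finset.card_range, nsmul_eq_mul,
    mul_one] at h
  exact absurd hN h.not_gt

/-- The indicator of `Fᶜ` turns `avoidProb` into the probability to avoid `F` at the times
`0, …, t`, which decreases in `t`. -/
theorem indicator_avoidProb_antitone (hp : ∀ v, 0 ≤ p v) (hp1 : ∑ v, p v = 1) (F : Set E)
    (x : E) : Antitone fun t => Fᶜ.indicator (avoidProb p next F Set.univ t) x := by
  refine antitone_nat_of_succ_le fun t => ?_
  induction t generalizing x with
  | zero =>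
    refine Set.indicator_le_indicator ?_
    simpa [avoidProb] using avoidProb_le_one (next := next) hp hp1 F Set.univ 1 x
  | succ t ih => exact Set.indicator_le_indicator (meanNext_mono hp fun v _ => ih _)

theorem exists_indicator_avoidProb_lt_one (hp : ∀ v, 0 ≤ p v) (hp1 : ∑ v, p v = 1) {F : Set E}
    {x y : E} (hy : y ∈ F) (hxy : Reach p next x y) :
    ∃ t, Fᶜ.indicator (avoidProb p next F Set.univ t) x < 1 := by
  induction hxy using Relation.ReflTransGen.head_induction_on with
  | refl => exact ⟨0, by simp [hy]⟩
  | @head a c hac _ ih =>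
    obtain ⟨v, hv, rfl⟩ := hac
    obtain ⟨t, ht⟩ := ih
    refine ⟨t + 1, (Set.indicator_apply_le' (fun _ => le_rfl)
      fun _ => avoidProb_nonneg hp _ _ _ _).trans_lt ?_⟩
    rw [← hp1]
    refine Finset.sum_lt_sum (fun w _ => ?_) ⟨v, Finset.mem_univ v, ?_⟩
    · exact mul_le_of_le_one_right (hp w) (Set.indicator_apply_le'
        (fun _ => avoidProb_le_one hp hp1 _ _ _ _) fun _ => zero_le_one)
    · exact mul_lt_of_lt_one_right hv ht

theorem exists_avoidProb_pos_iff_reach (hp : ∀ v, 0 ≤ p v) (x y : E) :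
    (∃ t, 0 < avoidProb p next ∅ {y} t x) ↔ Reach p next x y := by
  constructor
  · rintro ⟨t, ht⟩
    induction t generalizing x with
    | zero =>
      by_cases hxy : x = y
      · exact hxy ▸ Relation.ReflTransGen.refl
      · simp [avoidProb, hxy] at ht
    | succ t ih =>
      simp only [avoidProb, meanNext, Set.compl_empty, Set.indicator_univ] at ht
      obtain ⟨v, -, hv⟩ := Finset.exists_lt_of_sum_lt
        (f := fun _ : V => (0 : ℝ)) (s := Finset.univ) (by simpa using ht)
      have hpv : 0 < p v := (hp v).lt_of_ne fun h => by simp [← h] at hv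
      exact Relation.ReflTransGen.head ⟨v, hpv, rfl⟩ (ih _ ((pos_iff_pos_of_mul_pos hv).mp hpv))
  · intro h
    induction h using Relation.ReflTransGen.head_induction_on with
    | refl => exact ⟨0, by simp [avoidProb]⟩
    | @head a c hac _ ih =>
      obtain ⟨v, hv, rfl⟩ := hac
      obtain ⟨t, ht⟩ := ih
      refine ⟨t + 1, ?_⟩
      simp only [avoidProb, meanNext, Set.compl_empty, Set.indicator_univ]
      exact Finset.sum_pos' (fun w _ => mul_nonneg (hp w) (avoidProb_nonneg hp _ _ _ _))
        ⟨v, Finset.mem_univ v, mul_pos hv ht⟩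

/-- A Foster function for a finite set `B` yields one for any set `F` that can be reached from
every state of `B`. If `w k` is the probability to avoid `F` at the times `0, …, k`, then outside
of `F` the function `∑ k < T, w k` decreases on average by `1 - w T`, which is nonnegative, and
positive on `B` for large `T`. A large multiple of it makes up for the failure of the drift
condition on `B`. -/
theorem exists_drift_of_reach (hp : ∀ v, 0 ≤ p v) (hp1 : ∑ v, p v = 1) {B F : Set E}
    (hfin : B.Finite) {φ : E → ℝ} (hφ0 : ∀ x, 0 ≤ φ x)
    (hφ : ∀ x, x ∉ B → 1 + meanNext p next φ x ≤ φ x)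
    (hF : ∀ b ∈ B, b ∉ F → ∃ y ∈ F, Reach p next b y) :
    ∃ ψ : E → ℝ, (∀ x, 0 ≤ ψ x) ∧ ∀ x, x ∉ F → 1 + meanNext p next ψ x ≤ ψ x := by
  set w : ℕ → E → ℝ := fun t => Fᶜ.indicator (avoidProb p next F Set.univ t) with hw
  have hanti : ∀ x, Antitone fun t => w t x := indicator_avoidProb_antitone hp hp1 F
  have hw0 : ∀ t x, 0 ≤ w t x := fun t x =>
    Set.indicator_nonneg (fun z _ => avoidProb_nonneg hp _ _ _ z) x
  have hw1 : ∀ t x, w t x ≤ 1 := fun t x =>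
    Set.indicator_apply_le' (fun _ => avoidProb_le_one hp hp1 _ _ _ _) fun _ => zero_le_one
  have hlt : ∀ b, ∃ t, b ∈ B → b ∉ F → w t b < 1 := by
    intro b
    by_cases hb : b ∈ B ∧ b ∉ F
    · obtain ⟨y, hy, hby⟩ := hF b hb.1 hb.2
      obtain ⟨t, ht⟩ := exists_indicator_avoidProb_lt_one hp hp1 hy hby
      exact ⟨t, fun _ _ => ht⟩
    · exact ⟨0, fun h1 h2 => absurd ⟨h1, h2⟩ hb⟩
  choose T₀ hT₀ using hlt
  obtain ⟨T, hT⟩ := (hfin.image T₀).bddAbove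
  obtain ⟨c₀, hc₀⟩ := (hfin.image fun b => (1 + meanNext p next φ b) / (1 - w T b)).bddAbove
  have hTlt : ∀ b ∈ B, b ∉ F → w T b < 1 := fun b hb hbF =>
    (hanti b (hT ⟨b, hb, rfl⟩)).trans_lt (hT₀ b hb hbF)
  set c := max c₀ 0
  refine ⟨fun x => φ x + c * ∑ t ∈ Finset.range T, w t x, fun x => ?_, fun x hx => ?_⟩
  · exact add_nonneg (hφ0 x)
      (mul_nonneg (le_max_right _ _) (Finset.sum_nonneg fun t _ => hw0 t x))
  · have hstep : ∀ t, meanNext p next (w t) x = w (t + 1) x := fun t => by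
      simp [hw, hx, avoidProb]
    have hsum : meanNext p next (fun y => ∑ t ∈ Finset.range T, w t y) x
        = ∑ t ∈ Finset.range T, w t x + w T x - 1 := by
      rw [meanNext_sum, Finset.sum_congr rfl fun t _ => hstep t]
      have h0 : w 0 x = 1 := by simp [hw, hx, avoidProb]
      have h1 := Finset.sum_range_succ (fun t => w t x) T
      have h2 := Finset.sum_range_succ' (fun t => w t x) T
      linarith
    rw [meanNext_add, meanNext_const_mul, hsum]
    by_cases hxB : x ∈ B
    · have hpos : 0 < 1 - w T x := sub_pos.mpr (hTlt x hxB hx)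
      have hc : (1 + meanNext p next φ x) / (1 - w T x) ≤ c :=
        (hc₀ ⟨x, hxB, rfl⟩).trans (le_max_left _ _)
      rw [div_le_iff₀ hpos] at hc
      linarith [hφ0 x]
    · have hc : 0 ≤ c * (1 - w T x) :=
        mul_nonneg (le_max_right _ _) (sub_nonneg.mpr (hw1 T x))
      linarith [hφ x hxB]

/-- If `L` decreases on average by one at all states that satisfy `I N`, where the properties
`I 0, …, I N` are passed on from each time to the next, then the expectation of `L` after `N`
steps is a function that decreases on average by one where `I 0` holds. -/
theorem drift_iterate_meanNext (hp : ∀ v, 0 ≤ p v) (hp1 : ∑ v, p v = 1) {L : E → ℝ} {N : ℕ}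
    (I : ℕ → E → Prop) (hI : ∀ k < N, ∀ x, I k x → ∀ v, I (k + 1) (next x v))
    (hL : ∀ x, I N x → 1 + meanNext p next L x ≤ L x) {x : E} (hx : I 0 x) :
    1 + meanNext p next ((meanNext p next)^[N] L) x ≤ (meanNext p next)^[N] L x := by
  suffices H : ∀ j ≤ N, ∀ y, I (N - j) y →
      1 + meanNext p next ((meanNext p next)^[j] L) y ≤ (meanNext p next)^[j] L y from
    H N le_rfl x (by simpa using hx)
  intro j
  induction j with
  | zero => exact fun _ y hy => hL y hy
  | succ j ih =>
    intro hj y hy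
    rw [Function.iterate_succ_apply']
    nth_rewrite 1 [← meanNext_const (next := next) hp1 1 y]
    rw [← meanNext_add]
    refine meanNext_mono hp fun v _ => ih (by omega) _ ?_
    have h := hI (N - (j + 1)) (by omega) y hy v
    rwa [show N - (j + 1) + 1 = N - j by omega] at h

end Kernel

end FiniteNoiseChain

/-! ### Random orbits -/

namespace FiniteNoiseChain

/-- The path of the chain that starts from `x` and is driven by the noise `ξ 0, ξ 1, …`. -/
def orbit {E V : Type*} (next : E → V → E) (x : E) (ξ : ℕ → V) : ℕ → E
  | 0 => x
  | t + 1 => next (orbit next x ξ t) (ξ t)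

theorem orbit_succ' {E V : Type*} (next : E → V → E) (x : E) (ξ : ℕ → V) (t : ℕ) :
    orbit next x ξ (t + 1) = orbit next (next x (ξ 0)) (fun k => ξ (k + 1)) t := by
  induction t with
  | zero => rfl
  | succ t ih => rw [orbit, ih]; rfl

theorem avoid_succ_iff {E V : Type*} (next : E → V → E) (F G : Set E) (x : E) (ξ : ℕ → V)
    (t : ℕ) :
    ((∀ s, 1 ≤ s → s ≤ t + 1 → orbit next x ξ s ∉ F) ∧ orbit next x ξ (t + 1) ∈ G) ↔
      next x (ξ 0) ∉ F ∧
        (∀ s, 1 ≤ s → s ≤ t → orbit next (next x (ξ 0)) (fun k => ξ (k + 1)) s ∉ F) ∧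
        orbit next (next x (ξ 0)) (fun k => ξ (k + 1)) t ∈ G := by
  rw [orbit_succ']
  constructor
  · rintro ⟨h1, h2⟩
    refine ⟨h1 1 le_rfl (by omega), fun s _ hs2 => ?_, h2⟩
    have h := h1 (s + 1) (by omega) (by omega)
    rwa [orbit_succ'] at h
  · rintro ⟨h0, h1, h2⟩
    refine ⟨fun s hs1 hs2 => ?_, h2⟩
    obtain ⟨s, rfl⟩ : ∃ k, s = k + 1 := ⟨s - 1, by omega⟩
    rw [orbit_succ']
    rcases Nat.eq_zero_or_pos s with rfl | hs
    · exact h0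
    · exact h1 s hs (by omega)

theorem toENNReal_eq_tsum (m : ℕ∞) : (m : ℝ≥0∞) = ∑' t : ℕ, if (t : ℕ∞) < m then 1 else 0 := by
  induction m using ENat.recTopCoe with
  | top => simp
  | coe m =>
    rw [tsum_eq_sum (s := Finset.range m) fun t ht => by simpa using ht]
    rw [Finset.sum_congr rfl fun t ht => if_pos (by simpa using ht)]
    simp

theorem lt_returnTime_iff {E : Type} {Ω : Type u} {X : E → ℕ → Ω → E} {x : E} {F : Set E}
    {ω : Ω} {t : ℕ} :
    (t : ℕ∞) < OracleScheduling.returnTime X x F ω ↔ ∀ s, 1 ≤ s → s ≤ t → X x s ω ∉ F := by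
  constructor
  · intro h s hs1 hst hs
    refine h.not_ge (le_trans (sInf_le ⟨s, rfl, hs1, hs⟩) (by exact_mod_cast hst))
  · intro h
    refine lt_of_lt_of_le (b := ((t + 1 : ℕ) : ℕ∞)) (by exact_mod_cast t.lt_succ_self) ?_
    refine le_sInf ?_
    rintro _ ⟨s, rfl, hs1, hs⟩
    by_contra! hlt
    exact h s hs1 (Nat.lt_succ_iff.mp (by exact_mod_cast hlt)) hs

section Probability

variable {E : Type} {V : Type*} [Fintype V] [MeasurableSpace V] [MeasurableSingletonClass V]
  {p : V → ℝ} {next : E → V → E}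
  {Ω : Type u} [MeasurableSpace Ω] {μ : Measure Ω} [IsProbabilityMeasure μ] {ξ : ℕ → Ω → V}

theorem sum_measureReal_inter_fiber {Y : Ω → V} (hY : Measurable Y) (s : Set Ω) :
    ∑ v, μ.real (s ∩ {ω | Y ω = v}) = μ.real s := by
  have h := sum_measureReal_preimage_singleton (μ := μ.restrict s) (Finset.univ : Finset V)
    (f := Y) (fun v _ => hY (measurableSet_singleton v))
  simp only [Finset.coe_univ, Set.preimage_univ, measureReal_restrict_apply_univ] at h
  rw [← h]
  refine Finset.sum_congr rfl fun v _ => ?_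
  rw [measureReal_restrict_apply (hY (measurableSet_singleton v)), Set.inter_comm]
  rfl

/-- The Markov property at time `s`, given the noise up to then. -/
theorem measureReal_cylinder_inter_avoid (hξ : ∀ t, Measurable (ξ t))
    (hcyl : ∀ (t : ℕ) (w : ℕ → V),
      μ.real {ω | ∀ k < t, ξ k ω = w k} = ∏ k ∈ Finset.range t, p (w k))
    (F G : Set E) (t : ℕ) (x : E) (s : ℕ) (w : ℕ → V) :
    μ.real {ω | (∀ k < s, ξ k ω = w k) ∧
        (∀ j, 1 ≤ j → j ≤ t → orbit next x (fun k => ξ (s + k) ω) j ∉ F) ∧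
        orbit next x (fun k => ξ (s + k) ω) t ∈ G} =
      (∏ k ∈ Finset.range s, p (w k)) * avoidProb p next F G t x := by
  induction t generalizing x s w with
  | zero =>
    by_cases hx : x ∈ G
    · rw [← hcyl s w]
      simp only [avoidProb, hx, Set.indicator_of_mem, Pi.one_apply, mul_one]
      congr 1
      ext ω
      simp only [Set.mem_ofPred_eq, and_iff_left_iff_imp]
      exact fun _ => ⟨fun j h1 h2 => by omega, hx⟩
    · have hempty : ∀ ω, orbit next x (fun k => ξ (s + k) ω) 0 ∉ G := fun _ => hx
      simp [avoidProb, hx, hempty]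
  | succ t ih =>
    rw [← sum_measureReal_inter_fiber (hξ s), avoidProb, meanNext, Finset.mul_sum]
    refine Finset.sum_congr rfl fun v _ => ?_
    by_cases hF : next x v ∈ F
    · have hempty : {ω | (∀ k < s, ξ k ω = w k) ∧
          (∀ j, 1 ≤ j → j ≤ t + 1 → orbit next x (fun k => ξ (s + k) ω) j ∉ F) ∧
          orbit next x (fun k => ξ (s + k) ω) (t + 1) ∈ G} ∩ {ω | ξ s ω = v} = ∅ := by
        refine Set.eq_empty_of_forall_notMem fun ω hω => ?_
        obtain ⟨⟨-, h, -⟩, hv⟩ := hω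
        refine h 1 le_rfl (by omega) ?_
        change next x (ξ s ω) ∈ F
        rwa [show ξ s ω = v from hv]
      simp [hempty, hF]
    · have hprod : ∏ k ∈ Finset.range (s + 1), p (Function.update w s v k)
          = (∏ k ∈ Finset.range s, p (w k)) * p v := by
        rw [Finset.prod_range_succ, Function.update_self]
        congr 1
        exact Finset.prod_congr rfl fun k hk => by
          rw [Function.update_of_ne (Finset.mem_range.mp hk).ne]
      have h := ih (next x v) (s + 1) (Function.update w s v)
      rw [hprod] at h
      rw [Set.indicator_of_mem (by exact hF), ← mul_assoc, ← h]
      congr 1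
      ext ω
      simp only [Set.mem_inter_iff, Set.mem_ofPred_eq, avoid_succ_iff, add_zero]
      have hshift : (fun k => ξ (s + (k + 1)) ω) = fun k => ξ (s + 1 + k) ω := by
        ext k; congr 1; omega
      rw [hshift]
      have hupd : (∀ k < s + 1, ξ k ω = Function.update w s v k) ↔
          (∀ k < s, ξ k ω = w k) ∧ ξ s ω = v := by
        rw [Nat.forall_lt_succ_right, Function.update_self]
        refine and_congr_left' (forall₂_congr fun k hk => ?_)
        rw [Function.update_of_ne hk.ne]
      rw [hupd]
      constructor
      · rintro ⟨⟨h1, -, h2⟩, rfl⟩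
        exact ⟨⟨h1, rfl⟩, h2⟩
      · rintro ⟨⟨h1, rfl⟩, h2⟩
        exact ⟨⟨h1, hF, h2⟩, rfl⟩

theorem measureReal_avoid (hξ : ∀ t, Measurable (ξ t))
    (hcyl : ∀ (t : ℕ) (w : ℕ → V),
      μ.real {ω | ∀ k < t, ξ k ω = w k} = ∏ k ∈ Finset.range t, p (w k))
    (F G : Set E) (t : ℕ) (x : E) :
    μ.real {ω | (∀ j, 1 ≤ j → j ≤ t → orbit next x (fun k => ξ k ω) j ∉ F) ∧
        orbit next x (fun k => ξ k ω) t ∈ G} = avoidProb p next F G t x := by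
  cases isEmpty_or_nonempty V with
  | inl hV =>
    obtain ⟨ω⟩ := nonempty_of_isProbabilityMeasure μ
    exact (hV.false (ξ 0 ω)).elim
  | inr hV =>
    have h := measureReal_cylinder_inter_avoid (next := next) hξ hcyl F G t x 0
      (fun _ => Classical.arbitrary V)
    simpa using h

theorem measurableSet_orbit_mem (hξ : ∀ t, Measurable (ξ t)) (G : Set E) (t : ℕ) (x : E) :
    MeasurableSet {ω | orbit next x (fun k => ξ k ω) t ∈ G} := by
  induction t generalizing G with
  | zero => exact MeasurableSet.const (x ∈ G)
  | succ t ih =>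
    have h : {ω | orbit next x (fun k => ξ k ω) (t + 1) ∈ G} =
        ⋃ v, {ω | ξ t ω = v} ∩ {ω | orbit next x (fun k => ξ k ω) t ∈ {y | next y v ∈ G}} := by
      ext ω
      simp [orbit]
    rw [h]
    exact MeasurableSet.iUnion fun v => (hξ t (measurableSet_singleton v)).inter (ih _)

theorem measurableSet_lt_returnTime (hξ : ∀ t, Measurable (ξ t)) (F : Set E) (x : E) (t : ℕ) :
    MeasurableSet {ω | (t : ℕ∞) < OracleScheduling.returnTime
      (fun x t ω => orbit next x (fun k => ξ k ω) t) x F ω} := by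
  simp only [lt_returnTime_iff, Set.ofPred_forall]
  exact MeasurableSet.iInter fun s => MeasurableSet.iInter fun _ => MeasurableSet.iInter fun _ =>
    measurableSet_orbit_mem hξ Fᶜ s x

theorem measurable_returnTime (hξ : ∀ t, Measurable (ξ t)) (F : Set E) (x : E) :
    Measurable fun ω => (OracleScheduling.returnTime
      (fun x t ω => orbit next x (fun k => ξ k ω) t) x F ω : ℝ≥0∞) := by
  simp only [toENNReal_eq_tsum]
  exact Measurable.tsum fun t =>
    Measurable.ite (measurableSet_lt_returnTime hξ F x t) measurable_const measurable_const

theorem meanReturnTime_lt_top (hξ : ∀ t, Measurable (ξ t))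
    (hcyl : ∀ (t : ℕ) (w : ℕ → V),
      μ.real {ω | ∀ k < t, ξ k ω = w k} = ∏ k ∈ Finset.range t, p (w k))
    (hp : ∀ v, 0 ≤ p v) {F : Set E} {x : E} {c : ℝ}
    (hc : ∀ N, ∑ t ∈ Finset.range N, avoidProb p next F Set.univ t x ≤ c) :
    OracleScheduling.meanReturnTime μ (fun x t ω => orbit next x (fun k => ξ k ω) t) x F < ∞ := by
  have hmeas := measurableSet_lt_returnTime (next := next) hξ F x
  have hterm : ∀ t : ℕ, ∫⁻ ω, (if (t : ℕ∞) < OracleScheduling.returnTime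
      (fun x t ω => orbit next x (fun k => ξ k ω) t) x F ω then 1 else 0 : ℝ≥0∞) ∂μ =
      ENNReal.ofReal (avoidProb p next F Set.univ t x) := fun t => by
    rw [← measureReal_avoid hξ hcyl, ofReal_measureReal]
    have h : {ω | (∀ j, 1 ≤ j → j ≤ t → orbit next x (fun k => ξ k ω) j ∉ F) ∧
        orbit next x (fun k => ξ k ω) t ∈ Set.univ} = {ω | (t : ℕ∞) < OracleScheduling.returnTime
          (fun x t ω => orbit next x (fun k => ξ k ω) t) x F ω} := by
      ext ω
      simp [lt_returnTime_iff]
    rw [h, ← lintegral_indicator_one (hmeas t)]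
    exact lintegral_congr fun ω => by simp [Set.indicator]
  simp only [OracleScheduling.meanReturnTime, toENNReal_eq_tsum]
  rw [lintegral_tsum fun t =>
    (Measurable.ite (hmeas t) measurable_const measurable_const).aemeasurable]
  simp only [hterm]
  refine lt_of_le_of_lt (ENNReal.tsum_le_of_sum_range_le fun N => ?_)
    (ENNReal.ofReal_lt_top (r := c))
  rw [← ENNReal.ofReal_sum_of_nonneg fun t _ => avoidProb_nonneg hp _ _ _ _]
  exact ENNReal.ofReal_le_ofReal (hc N)

theorem accessible_iff_reach (hξ : ∀ t, Measurable (ξ t))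
    (hcyl : ∀ (t : ℕ) (w : ℕ → V),
      μ.real {ω | ∀ k < t, ξ k ω = w k} = ∏ k ∈ Finset.range t, p (w k))
    (hp : ∀ v, 0 ≤ p v) (x y : E) :
    OracleScheduling.Accessible μ (fun x t ω => orbit next x (fun k => ξ k ω) t) x y ↔
      Reach p next x y := by
  rw [← exists_avoidProb_pos_iff_reach hp]
  refine exists_congr fun t => ?_
  rw [← measureReal_avoid hξ hcyl, measureReal_def, ENNReal.toReal_pos_iff]
  simp [measure_lt_top]

/-- A chain with a Foster function for a finite set is positive recurrent. -/
theorem positiveRecurrentChain_of_drift (hξ : ∀ t, Measurable (ξ t))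
    (hcyl : ∀ (t : ℕ) (w : ℕ → V),
      μ.real {ω | ∀ k < t, ξ k ω = w k} = ∏ k ∈ Finset.range t, p (w k))
    (hp : ∀ v, 0 ≤ p v) (hp1 : ∑ v, p v = 1) {B : Set E} (hfin : B.Finite) {φ : E → ℝ}
    (hφ0 : ∀ x, 0 ≤ φ x) (hφ : ∀ x, x ∉ B → 1 + meanNext p next φ x ≤ φ x) :
    OracleScheduling.PositiveRecurrentChain μ
      (fun x t ω => orbit next x (fun k => ξ k ω) t) := by
  have hess : ∀ x, (∀ y, Reach p next x y → Reach p next y x) →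
      OracleScheduling.PositiveRecurrentState μ
        (fun x t ω => orbit next x (fun k => ξ k ω) t) x := by
    intro x hx
    -- Outside of `x` and of the states that the chain from `x` never visits, a Foster function
    -- exists because `x` can be reached from all other states.
    obtain ⟨ψ, hψ0, hψ⟩ := exists_drift_of_reach (F := {x} ∪ {y | ¬ Reach p next x y})
      hp hp1 hfin hφ0 hφ fun b _ hbF =>
        ⟨x, Or.inl rfl, hx b (by by_contra hb; exact hbF (Or.inr hb))⟩
    have hmean := meanReturnTime_lt_top (F := {x}) hξ hcyl hp fun N =>
      sum_avoidProb_le hp hp1 (C := {y | Reach p next x y}) (fun y hy v hv => Reach.step hy hv)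
        hψ0 (fun y hy hyx => hψ y fun h => h.elim hyx fun h => h hy) N Relation.ReflTransGen.refl
    refine ⟨?_, hmean⟩
    filter_upwards [ae_lt_top (measurable_returnTime hξ {x} x) hmean.ne] with ω hω
    exact ENat.toENNReal_lt_top.mp hω
  refine ⟨fun x hx => hess x fun y hy => ?_, B ∩ {e | ∀ y, Reach p next e y → Reach p next y e},
    hfin.inter_of_left _, fun y hy => hess y hy.2, fun x => ?_⟩
  · simp only [OracleScheduling.EssentialState, accessible_iff_reach hξ hcyl hp] at hx
    exact hx y hy
  · obtain ⟨ψ, hψ0, hψ⟩ := exists_drift_of_reach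
      (F := B ∩ {e | ∀ y, Reach p next e y → Reach p next y e}) hp hp1 hfin hφ0 hφ fun b _ _ => by
        obtain ⟨e, heB, he, hbe⟩ :=
          exists_reach_essential hfin (exists_reach_of_drift hp hp1 hφ0 hφ) b
        exact ⟨e, ⟨heB, he⟩, hbe⟩
    exact meanReturnTime_lt_top hξ hcyl hp fun N =>
      sum_avoidProb_le hp hp1 (C := Set.univ) (fun _ _ _ _ => trivial) hψ0
        (fun y _ => hψ y) N trivial

end Probability

end FiniteNoiseChain

namespace OracleScheduling

open FiniteNoiseChain

/-! ### Bernoulli arrivals -/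

/-- The probability that the arrivals in a time slot are `v`. -/
def arrivalProb {n : ℕ} (r : Fin n → ℝ) (v : Fin n → Fin 2) : ℝ :=
  ∏ i, if v i = 1 then r i else 1 - r i

theorem sum_prod_fin_two {n : ℕ} (c : Fin n → Fin 2 → ℝ) :
    ∑ v : Fin n → Fin 2, ∏ i, c i (v i) = ∏ i, (c i 0 + c i 1) := by
  have h := Finset.prod_univ_sum (fun _ : Fin n => (Finset.univ : Finset (Fin 2))) c
  simp only [Fintype.piFinset_univ, Fin.sum_univ_two] at h
  exact h.symm

theorem sum_arrivalProb {n : ℕ} (r : Fin n → ℝ) : ∑ v, arrivalProb r v = 1 := by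
  simp only [arrivalProb]
  rw [sum_prod_fin_two fun i e => if e = 1 then r i else 1 - r i]
  simp

theorem sum_arrivalProb_mul {n : ℕ} (r : Fin n → ℝ) (j : Fin n) :
    ∑ v, arrivalProb r v * ((v j : ℕ) : ℝ) = r j := by
  have h := sum_prod_fin_two fun i e =>
    (if e = 1 then r i else 1 - r i) * if i = j then ((e : ℕ) : ℝ) else 1
  simp only [Finset.prod_mul_distrib, Finset.prod_ite_eq', Finset.mem_univ, if_true] at h
  rw [show ∑ v, arrivalProb r v * ((v j : ℕ) : ℝ) = _ from h]
  rw [Finset.prod_eq_single j]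
  · simp
  · intro i _ hij
    simp [hij]
  · simp

namespace IsBernoulliArrivals

variable {n : ℕ} {Ω : Type u} [MeasurableSpace Ω] {μ : Measure Ω} {r : Fin n → ℝ}
  {A : ℕ → Fin n → Ω → Fin 2}

theorem measureReal_eq_one (hA : IsBernoulliArrivals μ r A) (t : ℕ) (i : Fin n) :
    μ.real {ω | A t i ω = 1} = r i := by
  have hmeas : MeasurableSet {ω | A t i ω = 1} :=
    hA.measurable t i (measurableSet_singleton 1)
  rw [← hA.mean t i, ← integral_indicator_one hmeas]
  refine integral_congr_ae (Filter.Eventually.of_forall fun ω => ?_)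
  obtain h | h : A t i ω = 0 ∨ A t i ω = 1 := by omega
  all_goals simp [Set.indicator, h]

variable [IsProbabilityMeasure μ]

theorem measureReal_eq (hA : IsBernoulliArrivals μ r A) (t : ℕ) (i : Fin n) (e : Fin 2) :
    μ.real {ω | A t i ω = e} = if e = 1 then r i else 1 - r i := by
  split_ifs with he
  · rw [he, hA.measureReal_eq_one]
  · have hmeas : MeasurableSet {ω | A t i ω = 1} :=
      hA.measurable t i (measurableSet_singleton 1)
    rw [← hA.measureReal_eq_one t i, ← probReal_compl_eq_one_sub hmeas]
    congr 1
    ext ω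
    change A t i ω = e ↔ ¬ A t i ω = 1
    omega

theorem arrivalProb_nonneg (hA : IsBernoulliArrivals μ r A) (v : Fin n → Fin 2) :
    0 ≤ arrivalProb r v :=
  Finset.prod_nonneg fun i _ => by
    rw [← hA.measureReal_eq 0 i (v i)]
    exact measureReal_nonneg

theorem measureReal_cylinder (hA : IsBernoulliArrivals μ r A) (t : ℕ)
    (w : ℕ → Fin n → Fin 2) :
    μ.real {ω | ∀ k < t, (fun i => A k i ω) = w k} =
      ∏ k ∈ Finset.range t, arrivalProb r (w k) := by
  have h := hA.indep.measure_inter_preimage_eq_mul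
    (Finset.range t ×ˢ (Finset.univ : Finset (Fin n))) (sets := fun p => {w p.1 p.2})
    fun p _ => measurableSet_singleton _
  have hset : {ω | ∀ k < t, (fun i => A k i ω) = w k} =
      ⋂ p ∈ Finset.range t ×ˢ (Finset.univ : Finset (Fin n)),
        (fun ω => A p.1 p.2 ω) ⁻¹' {w p.1 p.2} := by
    ext ω
    simp only [Set.mem_ofPred_eq, funext_iff, Set.mem_iInter, Finset.mem_product,
      Finset.mem_range, Finset.mem_univ, and_true, Set.mem_preimage, Set.mem_singleton_iff]
    exact ⟨fun h p hp => h p.1 hp p.2, fun h k hk i => h (k, i) hk⟩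
  rw [hset, measureReal_def, h, ENNReal.toReal_prod, Finset.prod_product]
  exact Finset.prod_congr rfl fun k _ => Finset.prod_congr rfl fun i _ =>
    hA.measureReal_eq k i (w k i)

end IsBernoulliArrivals

theorem chain_eq_orbit {n : ℕ} {S : Finset (Schedule n)} {𝔸 : Type} (O : Oracle S 𝔸)
    (f g : ℝ≥0 → ℝ≥0) {Ω : Type u} (A : ℕ → Fin n → Ω → Fin 2) :
    chain O f g A = fun x t ω => orbit (step O f g) x (fun k i => A k i ω) t := by
  funext x t ω
  induction t with
  | zero => rfl
  | succ t ih => rw [chain, ih, orbit]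

/-! ### Exhaustive search -/

/-- Comparing never lowers the weight of the schedule. -/
theorem weight_le_pickCompare {n : ℕ} {S : Finset (Schedule n)} (W : Fin n → ℕ)
    (a : Schedule n × S) : weight a.2 W ≤ weight (pickCompare S W a) W := by
  unfold pickCompare
  split_ifs with h
  · exact h.2.le
  · exact le_rfl

theorem weight_index_le_pickCompare {n : ℕ} {S : Finset (Schedule n)} (W : Fin n → ℕ)
    (a : Schedule n × S) (ha : a.1 ∈ S) : weight a.1 W ≤ weight (pickCompare S W a) W := by
  unfold pickCompare
  split_ifs with h
  · exact le_rfl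
  · exact not_lt.mp fun h' => h ⟨ha, h'⟩

theorem finFunctionFinEquiv_iterate_nextIndex {n : ℕ} (ρ : Schedule n) (s : ℕ) :
    (finFunctionFinEquiv (nextIndex^[s] ρ) : ℕ) = (finFunctionFinEquiv ρ + s) % 2 ^ n := by
  induction s with
  | zero => exact (Nat.mod_eq_of_lt (finFunctionFinEquiv ρ).isLt).symm
  | succ s ih =>
    rw [Function.iterate_succ_apply', nextIndex, Equiv.apply_symm_apply]
    simp [ih, add_assoc]

/-- The search index runs through all schedules within `2 ^ n` steps. -/
theorem exists_iterate_nextIndex_eq {n : ℕ} (ρ₀ ρ : Schedule n) :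
    ∃ s < 2 ^ n, nextIndex^[s] ρ₀ = ρ := by
  have h₀ := (finFunctionFinEquiv ρ₀ : Fin (2 ^ n)).isLt
  have h := (finFunctionFinEquiv ρ : Fin (2 ^ n)).isLt
  have hpos : 0 < 2 ^ n := by positivity
  refine ⟨(finFunctionFinEquiv ρ + (2 ^ n - finFunctionFinEquiv ρ₀)) % 2 ^ n,
    Nat.mod_lt _ hpos, finFunctionFinEquiv.injective (Fin.ext ?_)⟩
  rw [finFunctionFinEquiv_iterate_nextIndex, Nat.add_mod_mod,
    show (finFunctionFinEquiv ρ₀ + (finFunctionFinEquiv ρ + (2 ^ n - finFunctionFinEquiv ρ₀)) : ℕ)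
      = finFunctionFinEquiv ρ + 2 ^ n by omega, Nat.add_mod_right, Nat.mod_eq_of_lt h]

theorem iterate_advice_fst {n : ℕ} (S : Finset (Schedule n)) (W : Fin n → ℕ)
    (α : Schedule n × S) (t : ℕ) :
    (((esOracle S).advice W)^[t] α).1 = nextIndex^[t] α.1 := by
  induction t with
  | zero => rfl
  | succ t ih => rw [Function.iterate_succ_apply', Function.iterate_succ_apply', ← ih]; rfl

theorem monotone_weight_iterate_advice {n : ℕ} (S : Finset (Schedule n)) (W : Fin n → ℕ)
    (α : Schedule n × S) :
    Monotone fun t => weight (((esOracle S).advice W)^[t] α).2 W := by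
  refine monotone_nat_of_le_succ fun t => ?_
  rw [Function.iterate_succ_apply']
  exact weight_le_pickCompare W _

/-- With constant weights the oracle has compared all schedules after `2 ^ n` queries. -/
theorem weight_le_weight_sched_iterate {n : ℕ} (S : Finset (Schedule n)) (W : Fin n → ℕ)
    (α : Schedule n × S) {t : ℕ} (ht : 2 ^ n ≤ t) {ρ : Schedule n} (hρ : ρ ∈ S) :
    weight ρ W ≤ weight ((esOracle S).sched W (((esOracle S).advice W)^[t] α)) W := by
  obtain ⟨s, hs, rfl⟩ := exists_iterate_nextIndex_eq α.1 ρ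
  rw [← iterate_advice_fst S W] at hρ ⊢
  have h1 := weight_index_le_pickCompare W _ hρ
  have h2 := monotone_weight_iterate_advice S W α (show s + 1 ≤ t by omega)
  simp only [Function.iterate_succ_apply'] at h2
  exact h1.trans (h2.trans (weight_le_pickCompare W _))

/-! ### Slow variation of queues and weights -/

theorem nextQueue_le {n : ℕ} (σ : Schedule n) (Q : Fin n → ℕ) (A : Fin n → Fin 2) (i : Fin n) :
    nextQueue σ Q A i ≤ Q i + 1 := by
  unfold nextQueue
  have := (A i).isLt
  omega

theorem le_nextQueue {n : ℕ} (σ : Schedule n) (Q : Fin n → ℕ) (A : Fin n → Fin 2) (i : Fin n) :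
    Q i ≤ nextQueue σ Q A i + 1 := by
  unfold nextQueue
  have := (σ i).isLt
  split_ifs <;> omega

theorem Qmax_le_add_one {n : ℕ} {Q Q' : Fin n → ℕ} (h : ∀ i, Q i ≤ Q' i + 1) :
    Qmax Q ≤ Qmax Q' + 1 :=
  Finset.sup_le fun i hi => (h i).trans (Nat.add_le_add_right (Finset.le_sup hi) 1)

/-- The function `h` is nondecreasing, and grows by at most one from an integer to the next. -/
structure SlowGrowth (h : ℝ≥0 → ℝ≥0) : Prop where
  mono : Monotone h
  add_one_le : ∀ q : ℕ, h ((q + 1 : ℕ) : ℝ≥0) ≤ h q + 1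

theorem SlowGrowth.le_add_one {h : ℝ≥0 → ℝ≥0} (hh : SlowGrowth h) {q q' : ℕ} (hq : q ≤ q' + 1) :
    h q ≤ h q' + 1 :=
  (hh.mono (by exact_mod_cast hq)).trans (hh.add_one_le q')

theorem U_le_add_one {n : ℕ} {f g : ℝ≥0 → ℝ≥0} (hf : SlowGrowth f) (hg : SlowGrowth g)
    {Q Q' : Fin n → ℕ} (h : ∀ i, Q i ≤ Q' i + 1) (i : Fin n) : U f g Q i ≤ U f g Q' i + 1 :=
  max_le ((hf.le_add_one (h i)).trans (add_le_add_left (le_max_left _ _) 1))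
    ((hg.le_add_one (Qmax_le_add_one h)).trans (add_le_add_left (le_max_right _ _) 1))

section

variable {n : ℕ} {S : Finset (Schedule n)} {f g : ℝ≥0 → ℝ≥0}

theorem abs_step_W_sub_le {𝔸 : Type} (O : Oracle S 𝔸) (hf : SlowGrowth f) (hg : SlowGrowth g)
    (x : NetState S 𝔸 f g) (v : Fin n → Fin 2) (i : Fin n) :
    |((step O f g x v).W i : ℝ) - x.W i| ≤ 5 := by
  have h1 := abs_le.mp (x.close i)
  have h2 := abs_le.mp ((step O f g x v).close i)
  have h3 : U f g (step O f g x v).Q i ≤ U f g x.Q i + 1 :=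
    U_le_add_one hf hg (nextQueue_le x.σ.1 x.Q v) i
  have h4 : U f g x.Q i ≤ U f g (step O f g x v).Q i + 1 :=
    U_le_add_one hf hg (le_nextQueue x.σ.1 x.Q v) i
  have h3' : (U f g (step O f g x v).Q i : ℝ) ≤ U f g x.Q i + 1 := by exact_mod_cast h3
  have h4' : (U f g x.Q i : ℝ) ≤ U f g (step O f g x v).Q i + 1 := by exact_mod_cast h4
  rw [abs_le]
  constructor <;> linarith [h1.1, h1.2, h2.1, h2.2]

theorem weight_le_of_le_add {ρ : Schedule n} {W W' : Fin n → ℕ} {c : ℕ}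
    (h : ∀ i, W i ≤ W' i + c) : weight ρ W ≤ weight ρ W' + c * n := by
  calc weight ρ W ≤ ∑ i : Fin n, ((ρ i : ℕ) * W' i + c) := Finset.sum_le_sum fun i _ => by
        obtain hi | hi : ρ i = 0 ∨ ρ i = 1 := by omega
        · simp [hi]
        · simpa [hi] using h i
    _ = weight ρ W' + c * n := by
        simp [weight, Finset.sum_add_distrib, mul_comm]

theorem weight_step_le {𝔸 : Type} (O : Oracle S 𝔸) (hf : SlowGrowth f) (hg : SlowGrowth g)
    (x : NetState S 𝔸 f g) (v : Fin n → Fin 2) (ρ : Schedule n) :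
    weight ρ (step O f g x v).W ≤ weight ρ x.W + 5 * n :=
  weight_le_of_le_add fun i => by
    have h := (abs_le.mp (abs_step_W_sub_le O hf hg x v i)).2
    have h' : ((step O f g x v).W i : ℝ) ≤ x.W i + 5 := by linarith
    exact_mod_cast h'

theorem weight_le_step {𝔸 : Type} (O : Oracle S 𝔸) (hf : SlowGrowth f) (hg : SlowGrowth g)
    (x : NetState S 𝔸 f g) (v : Fin n → Fin 2) (ρ : Schedule n) :
    weight ρ x.W ≤ weight ρ (step O f g x v).W + 5 * n :=
  weight_le_of_le_add fun i => by
    have h := (abs_le.mp (abs_step_W_sub_le O hf hg x v i)).1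
    have h' : (x.W i : ℝ) ≤ (step O f g x v).W i + 5 := by linarith
    exact_mod_cast h'

/-- The progress of the search `k` steps after its start: every available schedule either comes up
for comparison before step `2 ^ n`, or is heavier than the schedule in the advice by at most
`10 * n` for each past step, since in one step the weights of two schedules change by at most
`5 * n` each. Moreover the longest queue will still exceed `K` at step `2 ^ n`, and from the first
step on the current schedule is the one in the advice. -/
def SearchProgress (K k : ℕ) (x : NetState S (Schedule n × S) f g) : Prop :=
  K + (2 ^ n - k) < Qmax x.Q ∧ (0 < k → x.σ = x.a.2) ∧
    ∀ ρ ∈ S, (∃ j, j + k < 2 ^ n ∧ nextIndex^[j] x.a.1 = ρ) ∨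
      weight ρ x.W ≤ weight x.a.2 x.W + 10 * n * k

theorem searchProgress_zero {K : ℕ} {x : NetState S (Schedule n × S) f g}
    (hx : K + 2 ^ n < Qmax x.Q) : SearchProgress K 0 x :=
  ⟨by simpa using hx, fun h => absurd h (lt_irrefl 0),
    fun ρ _ => Or.inl (by simpa using exists_iterate_nextIndex_eq x.a.1 ρ)⟩

theorem SearchProgress.step (hf : SlowGrowth f) (hg : SlowGrowth g) {K k : ℕ} (hk : k < 2 ^ n)
    {x : NetState S (Schedule n × S) f g} (hx : SearchProgress K k x) (v : Fin n → Fin 2) :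
    SearchProgress K (k + 1) (step (esOracle S) f g x v) := by
  obtain ⟨hQ, -, hW⟩ := hx
  refine ⟨?_, fun _ => rfl, fun ρ hρ => ?_⟩
  · have h : Qmax x.Q ≤ Qmax (OracleScheduling.step (esOracle S) f g x v).Q + 1 :=
      Qmax_le_add_one (le_nextQueue x.σ.1 x.Q v)
    omega
  · have hbest : ∀ m, weight ρ x.W ≤ weight (pickCompare S x.W x.a) x.W + 10 * n * m →
        weight ρ (OracleScheduling.step (esOracle S) f g x v).W ≤
          weight (pickCompare S x.W x.a) (OracleScheduling.step (esOracle S) f g x v).W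
            + 10 * n * (m + 1) := fun m hm => by
      have h1 := weight_step_le (esOracle S) hf hg x v ρ
      have h2 := weight_le_step (esOracle S) hf hg x v (pickCompare S x.W x.a)
      have h3 : 10 * n * (m + 1) = 10 * n * m + 5 * n + 5 * n := by ring
      omega
    rcases hW ρ hρ with ⟨j, hj, rfl⟩ | h
    · cases j with
      | zero =>
        refine Or.inr ((hbest 0 ?_).trans ?_)
        · simpa using weight_index_le_pickCompare x.W x.a hρ
        · exact Nat.add_le_add_left (Nat.mul_le_mul_left _ (by omega)) _
      | succ j => exact Or.inl ⟨j, by omega, rfl⟩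
    · exact Or.inr (hbest k (h.trans (Nat.add_le_add_right (weight_le_pickCompare x.W x.a) _)))

/-! ### The Lyapunov function -/

/-- A discrete primitive of `f`, summed over the queues. -/
noncomputable def lyapunov {𝔸 : Type} (x : NetState S 𝔸 f g) : ℝ :=
  ∑ i, ∑ q ∈ Finset.range (x.Q i), (f q : ℝ)

/-- Because `f 0 = 0`, a service that is wasted on an empty queue does not matter. -/
theorem lyapunov_step_le {𝔸 : Type} (O : Oracle S 𝔸) (hf : SlowGrowth f) (hf0 : f 0 = 0)
    (x : NetState S 𝔸 f g) (v : Fin n → Fin 2) :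
    lyapunov (step O f g x v) ≤
      lyapunov x + ∑ i, ((((v i : ℕ) : ℝ) - ((x.σ.1 i : ℕ) : ℝ)) * (f (x.Q i) : ℝ) + 1) := by
  rw [lyapunov, lyapunov, ← Finset.sum_add_distrib]
  refine Finset.sum_le_sum fun i _ => ?_
  change ∑ q ∈ Finset.range (nextQueue x.σ x.Q v i), (f q : ℝ) ≤ _
  unfold nextQueue
  obtain hv | hv : v i = 0 ∨ v i = 1 := by omega
  all_goals
    obtain hs | hs : x.σ.1 i = 0 ∨ x.σ.1 i = 1 := by omega
  all_goals
    rcases Nat.eq_zero_or_pos (x.Q i) with hQ | hQ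
  all_goals simp [hv, hs, hQ, hf0, Finset.sum_range_succ]
  -- The remaining case is a departure without an arrival, where `∑ q < Q i, f q` loses
  -- `f (Q i - 1)`, which is at least `f (Q i) - 1`.
  obtain ⟨q, hq⟩ : ∃ q, x.Q i = q + 1 := ⟨x.Q i - 1, by omega⟩
  have h := hf.add_one_le q
  have h' : (f ((q + 1 : ℕ) : ℝ≥0) : ℝ) ≤ f q + 1 := by exact_mod_cast h
  rw [hq, Nat.add_sub_cancel, Finset.sum_range_succ]
  linarith

theorem meanNext_lyapunov_le {𝔸 : Type} (O : Oracle S 𝔸) (hf : SlowGrowth f) (hf0 : f 0 = 0)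
    {r : Fin n → ℝ} (hr : ∀ v, 0 ≤ arrivalProb r v) (x : NetState S 𝔸 f g) :
    meanNext (arrivalProb r) (step O f g) lyapunov x ≤
      lyapunov x + ∑ i, ((r i - ((x.σ.1 i : ℕ) : ℝ)) * (f (x.Q i) : ℝ) + 1) := by
  calc meanNext (arrivalProb r) (step O f g) lyapunov x
      ≤ ∑ v, arrivalProb r v * (lyapunov x +
          ∑ i, ((((v i : ℕ) : ℝ) - ((x.σ.1 i : ℕ) : ℝ)) * (f (x.Q i) : ℝ) + 1)) :=
        Finset.sum_le_sum fun v _ =>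
          mul_le_mul_of_nonneg_left (lyapunov_step_le O hf hf0 x v) (hr v)
    _ = lyapunov x + ∑ i, ((r i - ((x.σ.1 i : ℕ) : ℝ)) * (f (x.Q i) : ℝ) + 1) := by
        have hterm : ∀ i, ∑ v, arrivalProb r v *
            ((((v i : ℕ) : ℝ) - ((x.σ.1 i : ℕ) : ℝ)) * (f (x.Q i) : ℝ) + 1) =
              (r i - ((x.σ.1 i : ℕ) : ℝ)) * (f (x.Q i) : ℝ) + 1 := fun i => by
          simp only [mul_add, mul_sub, sub_mul, Finset.sum_add_distrib, Finset.sum_sub_distrib,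
            ← mul_assoc, ← Finset.sum_mul, sum_arrivalProb_mul, sum_arrivalProb, one_mul]
        simp only [← hterm]
        rw [Finset.sum_comm]
        simp only [mul_add (arrivalProb r _) (lyapunov x), Finset.sum_add_distrib (f := fun v =>
          arrivalProb r v * lyapunov x), ← Finset.sum_mul, sum_arrivalProb, one_mul,
          ← Finset.mul_sum]

theorem sum_capacity_mul_le {c : Fin n → ℝ} (hc : c ∈ capacityRegion S) {σ : Schedule n}
    {W : Fin n → ℕ} {C : ℝ} (hσ : ∀ ρ ∈ S, (weight ρ W : ℝ) ≤ weight σ W + C) :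
    ∑ i, (c i - ((σ i : ℕ) : ℝ)) * W i ≤ C := by
  obtain ⟨α, hα0, hα1, hcα⟩ := hc
  have hcW : ∑ i, c i * W i = ∑ ρ ∈ S, α ρ * weight ρ W := by
    simp only [hcα, weight, Finset.sum_mul, Finset.mul_sum, Nat.cast_sum, Nat.cast_mul]
    rw [Finset.sum_comm]
    exact Finset.sum_congr rfl fun ρ _ => Finset.sum_congr rfl fun i _ => by ring
  have hle : ∑ ρ ∈ S, α ρ * weight ρ W ≤ ∑ ρ ∈ S, α ρ * (weight σ W + C) :=
    Finset.sum_le_sum fun ρ hρ => mul_le_mul_of_nonneg_left (hσ ρ hρ) (hα0 ρ hρ)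
  rw [← Finset.sum_mul, hα1, one_mul] at hle
  have hσW : ∑ i, ((σ i : ℕ) : ℝ) * W i = weight σ W := by simp [weight]
  simp only [sub_mul, Finset.sum_sub_distrib]
  linarith

theorem capacityRegion_mem_Icc {c : Fin n → ℝ} (hc : c ∈ capacityRegion S) (i : Fin n) :
    c i ∈ Set.Icc (0 : ℝ) 1 := by
  obtain ⟨α, hα0, hα1, hcα⟩ := hc
  rw [hcα i]
  refine ⟨Finset.sum_nonneg fun ρ hρ => mul_nonneg (hα0 ρ hρ) (Nat.cast_nonneg _), ?_⟩
  rw [← hα1]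
  refine Finset.sum_le_sum fun ρ hρ => mul_le_of_le_one_right (hα0 ρ hρ) ?_
  exact_mod_cast Nat.lt_succ_iff.mp (ρ i).isLt

/-- Since the weights differ from `f (Q i)` by at most `2 + g Q_max`, a schedule of nearly
maximal weight makes the Lyapunov function decrease by a multiple of `f Q_max`, up to terms of
order `g Q_max`. -/
theorem meanNext_lyapunov_le_of_weight_le {𝔸 : Type} (O : Oracle S 𝔸) (hf : SlowGrowth f)
    (hf0 : f 0 = 0) {r : Fin n → ℝ} (hr : ∀ v, 0 ≤ arrivalProb r v) {c : Fin n → ℝ}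
    (hc : c ∈ capacityRegion S) {ε : ℝ} (hε : 0 ≤ ε) (hrc : ∀ i, r i + ε ≤ c i) {C : ℝ}
    {x : NetState S 𝔸 f g} (hQ : 0 < Qmax x.Q)
    (hx : ∀ ρ ∈ S, (weight ρ x.W : ℝ) ≤ weight x.σ x.W + C) :
    meanNext (arrivalProb r) (step O f g) lyapunov x ≤
      lyapunov x + (n * g (Qmax x.Q) + (C + 3 * n)) - ε * f (Qmax x.Q) := by
  have hterm : ∀ i, (r i - ((x.σ.1 i : ℕ) : ℝ)) * (f (x.Q i) : ℝ) + 1 ≤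
      (c i - ((x.σ.1 i : ℕ) : ℝ)) * x.W i + (g (Qmax x.Q) + 3) - ε * f (x.Q i) := fun i => by
    have hc01 := capacityRegion_mem_Icc hc i
    have hσ0 : (0 : ℝ) ≤ ((x.σ.1 i : ℕ) : ℝ) := Nat.cast_nonneg _
    have hσ1 : ((x.σ.1 i : ℕ) : ℝ) ≤ 1 := by
      exact_mod_cast Nat.lt_succ_iff.mp (x.σ.1 i).isLt
    have hclose := abs_le.mp (x.close i)
    have hf' : (0 : ℝ) ≤ f (x.Q i) := NNReal.coe_nonneg _
    have hg' : (0 : ℝ) ≤ g (Qmax x.Q) := NNReal.coe_nonneg _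
    have hU1 : (f (x.Q i) : ℝ) ≤ U f g x.Q i := by exact_mod_cast le_max_left _ _
    have hU2 : (U f g x.Q i : ℝ) ≤ f (x.Q i) + g (Qmax x.Q) := by
      exact_mod_cast max_le (le_add_of_nonneg_right zero_le) (le_add_of_nonneg_left zero_le)
    have h1 : (r i - ((x.σ.1 i : ℕ) : ℝ)) * (f (x.Q i) : ℝ) ≤
        (c i - ((x.σ.1 i : ℕ) : ℝ)) * f (x.Q i) - ε * f (x.Q i) := by
      rw [← sub_mul]
      exact mul_le_mul_of_nonneg_right (by linarith [hrc i]) hf'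
    have h2 : |(c i - ((x.σ.1 i : ℕ) : ℝ)) * (f (x.Q i) - x.W i)| ≤ 1 * (g (Qmax x.Q) + 2) := by
      rw [abs_mul]
      refine mul_le_mul (abs_le.mpr ⟨?_, ?_⟩) (abs_le.mpr ⟨?_, ?_⟩) (abs_nonneg _) zero_le_one
      all_goals linarith [hc01.1, hc01.2, hclose.1, hclose.2]
    have h3 := (abs_le.mp h2).2
    rw [mul_sub] at h3
    linarith
  have hsum := Finset.sum_le_sum fun i (_ : i ∈ Finset.univ) => hterm i
  rw [Finset.sum_sub_distrib, Finset.sum_add_distrib, ← Finset.mul_sum] at hsum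
  simp only [Finset.sum_add_distrib, Finset.sum_const, Finset.card_univ, Fintype.card_fin,
    nsmul_eq_mul] at hsum
  have hne : (Finset.univ : Finset (Fin n)).Nonempty := by
    by_contra h
    rw [Finset.not_nonempty_iff_eq_empty] at h
    simp [Qmax, h] at hQ
  obtain ⟨j, -, hj⟩ := Finset.exists_mem_eq_sup Finset.univ hne x.Q
  have hmax : (f (Qmax x.Q) : ℝ) ≤ ∑ i, (f (x.Q i) : ℝ) := by
    rw [Qmax, hj]
    exact Finset.single_le_sum (f := fun i => (f (x.Q i) : ℝ)) (fun i _ => NNReal.coe_nonneg _)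
      (Finset.mem_univ j)
  have h1 := mul_le_mul_of_nonneg_left hmax hε
  have h2 := meanNext_lyapunov_le O hf hf0 hr x
  simp only [Finset.sum_add_distrib, Finset.sum_const, Finset.card_univ, Fintype.card_fin,
    nsmul_eq_mul] at h2
  have h3 := sum_capacity_mul_le hc hx
  linarith

theorem finite_Qmax_le {𝔸 : Type} [Finite 𝔸] (hf : Monotone f) (hg : Monotone g) (K : ℕ) :
    {x : NetState S 𝔸 f g | Qmax x.Q ≤ K}.Finite := by
  set M : ℕ := ⌈(max (f K) (g K) : ℝ≥0)⌉₊ + 2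
  let e : NetState S 𝔸 f g → S × (Fin n → ℕ) × 𝔸 × (Fin n → ℕ) := fun x => (x.σ, x.W, x.a, x.Q)
  have he : Function.Injective e := by
    rintro ⟨_, _, _, _, _⟩ ⟨_, _, _, _, _⟩ h
    simp only [e, Prod.mk.injEq] at h
    obtain ⟨rfl, rfl, rfl, rfl⟩ := h
    rfl
  have hfin : ((Set.univ : Set S) ×ˢ Set.Iic (fun _ : Fin n => M) ×ˢ (Set.univ : Set 𝔸) ×ˢ
      Set.Iic (fun _ : Fin n => K)).Finite :=
    Set.finite_univ.prod ((Set.finite_Iic _).prod (Set.finite_univ.prod (Set.finite_Iic _)))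
  refine (hfin.preimage he.injOn).subset fun x (hx : Qmax x.Q ≤ K) => ?_
  have hQ : ∀ i, x.Q i ≤ K := fun i => (Finset.le_sup (Finset.mem_univ i)).trans hx
  refine ⟨trivial, fun i => ?_, trivial, hQ⟩
  have h1 := (abs_le.mp (x.close i)).2
  have h2 : U f g x.Q i ≤ max (f K) (g K) :=
    max_le_max (hf (by exact_mod_cast hQ i)) (hg (by exact_mod_cast hx))
  have h3 : (U f g x.Q i : ℝ) ≤ (⌈(max (f K) (g K) : ℝ≥0)⌉₊ : ℝ) := by
    exact_mod_cast h2.trans (Nat.le_ceil _)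
  have h4 : (x.W i : ℝ) ≤ (M : ℝ) := by
    simp only [M]
    push_cast
    linarith
  exact_mod_cast h4

/-- Throughput optimality of exhaustive search for all slowly growing `f` and `g` such that `g`
is negligible compared with `f`. -/
theorem throughputOptimal_esOracle (hf : SlowGrowth f) (hg : SlowGrowth g) (hf0 : f 0 = 0)
    (hfg : ∀ ε C : ℝ, 0 < ε → ∃ K : ℕ, ∀ q ≥ K, n * (g q : ℝ) + C ≤ ε * f q) :
    ThroughputOptimal.{u} (esOracle S) f g := by
  rintro r ⟨-, c, hc, hrc⟩ Ω _ μ _ A hA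
  obtain ⟨ε, hε, hrcε⟩ := Pi.exists_forall_pos_add_lt hrc
  obtain ⟨K, hK⟩ := hfg ε (1 + (((10 * n * 2 ^ n : ℕ) : ℝ) + 3 * n)) hε
  have hp := hA.arrivalProb_nonneg
  rw [chain_eq_orbit]
  refine positiveRecurrentChain_of_drift (p := arrivalProb r)
    (ξ := fun k ω i => A k i ω) (next := step (esOracle S) f g)
    (fun t => measurable_pi_lambda _ fun i => hA.measurable t i) hA.measureReal_cylinder hp
    (sum_arrivalProb r) (finite_Qmax_le hf.mono hg.mono (K + 2 ^ n))
    (φ := (meanNext (arrivalProb r) (step (esOracle S) f g))^[2 ^ n] lyapunov)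
    (fun x => ?_) (fun x hx => ?_)
  · suffices H : ∀ (N : ℕ) (y : NetState S (Schedule n × S) f g),
        0 ≤ (meanNext (arrivalProb r) (step (esOracle S) f g))^[N] lyapunov y from H _ x
    intro N
    induction N with
    | zero =>
      intro y
      change 0 ≤ lyapunov y
      exact Finset.sum_nonneg fun i _ => Finset.sum_nonneg fun q _ => NNReal.coe_nonneg _
    | succ N ih =>
      intro y
      rw [Function.iterate_succ_apply']
      exact meanNext_nonneg hp ih y
  · refine drift_iterate_meanNext hp (sum_arrivalProb r) (SearchProgress K)
      (fun k hk y hy v => hy.step hf hg hk v) (fun y hy => ?_)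
      (searchProgress_zero (not_le.mp hx))
    obtain ⟨hQ, hσ, hW⟩ := hy
    have hweight : ∀ ρ ∈ S,
        (weight ρ y.W : ℝ) ≤ weight y.σ y.W + ((10 * n * 2 ^ n : ℕ) : ℝ) := fun ρ hρ => by
      rcases hW ρ hρ with ⟨j, hj, -⟩ | h
      · omega
      · rw [hσ (by positivity)]
        exact_mod_cast h
    have h1 := meanNext_lyapunov_le_of_weight_le (esOracle S) hf hf0 hp hc hε.le
      (fun i => (hrcε i).le) (by omega) hweight
    have h2 := hK (Qmax y.Q) (by omega)
    linarith

end

/-! ### Powers -/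

theorem slowGrowth_rpow {a : ℝ} (ha0 : 0 ≤ a) (ha1 : a ≤ 1) :
    SlowGrowth fun x : ℝ≥0 => x ^ a where
  mono := NNReal.monotone_rpow_of_nonneg ha0
  add_one_le q := by
    simpa using NNReal.rpow_add_le_add_rpow (q : ℝ≥0) 1 ha0 ha1

theorem exists_mul_rpow_add_le {a b : ℝ} (hb : 0 < b) (hba : b < a) (n : ℕ) (ε C : ℝ)
    (hε : 0 < ε) :
    ∃ K : ℕ, ∀ q ≥ K, n * (((q : ℝ≥0) ^ b : ℝ≥0) : ℝ) + C ≤ ε * (((q : ℝ≥0) ^ a : ℝ≥0) : ℝ) := by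
  have hlim : Filter.Tendsto (fun q : ℕ => ((q : ℝ) ^ b) * (ε * (q : ℝ) ^ (a - b) - n))
      Filter.atTop Filter.atTop := by
    have h1 := (tendsto_rpow_atTop hb).comp (tendsto_natCast_atTop_atTop (R := ℝ))
    have h2 := (tendsto_rpow_atTop (sub_pos.mpr hba)).comp (tendsto_natCast_atTop_atTop (R := ℝ))
    exact h1.atTop_mul_atTop₀
      (Filter.tendsto_atTop_add_const_right _ (-(n : ℝ)) (h2.const_mul_atTop hε))
  obtain ⟨K, hK⟩ := Filter.eventually_atTop.mp (hlim.eventually_ge_atTop C)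
  refine ⟨max K 1, fun q hq => ?_⟩
  have hq0 : (0 : ℝ) < q := by exact_mod_cast lt_of_lt_of_le (by simp) hq
  have h := hK q (le_of_max_le_left hq)
  have hmul : (q : ℝ) ^ b * (q : ℝ) ^ (a - b) = (q : ℝ) ^ a := by
    rw [← Real.rpow_add hq0]
    congr 1
    ring
  simp only [NNReal.coe_rpow, NNReal.coe_natCast]
  rw [← hmul]
  linarith

end OracleScheduling

theorem corollary1 (n : ℕ) (S : Finset (OracleScheduling.Schedule n)) (a b : ℝ)
    (hb : 0 < b) (hba : b < a) (ha : a < 1) :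
    OracleScheduling.ThroughputOptimal.{u} (OracleScheduling.esOracle S)
        (fun x => x ^ a) (fun x => x ^ b) ∧
      ∀ (W : Fin n → ℕ) (α : OracleScheduling.Schedule n × S) (t : ℕ), 2 ^ n ≤ t →
        ∀ ρ ∈ S, OracleScheduling.weight ρ W ≤
          OracleScheduling.weight
            ((OracleScheduling.esOracle S).sched W
              (((OracleScheduling.esOracle S).advice W)^[t] α)) W :=
  ⟨OracleScheduling.throughputOptimal_esOracle
      (OracleScheduling.slowGrowth_rpow (hb.trans hba).le ha.le)
      (OracleScheduling.slowGrowth_rpow hb.le (hba.trans ha).le)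
      (NNReal.zero_rpow (hb.trans hba).ne')
      (OracleScheduling.exists_mul_rpow_add_le hb hba n),
    fun W α _ ht _ hρ => OracleScheduling.weight_le_weight_sched_iterate S W α ht hρ⟩
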